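/- Theorem I. Manifolds are Hausdorff manifolds modelled on real Hausdorff locally convex topological vector spaces, and $C^r$-maps ($r\in\mathbb{N}\cup\{\infty\}$; smooth means $C^\infty$) are understood in the sense of Keller's $C^r_c$-theory (continuous iterated directional derivatives). A smooth map $f\colon X\to Y$ between smooth manifolds modelled on $E_X$ and $E_Y$ is called a smooth submersion if, around each point of $X$ and its image, there are smooth charts $\phi\colon U_\phi\to V_\phi\subseteq E_X$ and $\psi\colon U_\psi\to V_\psi\subseteq E_Y$ with $f(U_\phi)\subseteq U_\psi$ in which $f$ is the restriction to $V_\phi$ of a continuous linear map $\pi\colon E_X\to E_Y$ possessing a continuous linear right inverse. Let $G$ be a smooth Lie group which has an exponential function, i.e., for each $v\in L(G)=T_eG$ there is a smooth homomorphism $\gamma_v\colon(\mathbb{R},+)\to G$ with $\gamma_v'(0)=v$. Let $G\times M\to M$, $(g,y)\mapsto gy$ be a $C^1$-action of $G$ on a $C^1$-manifold $M$, let $x\in M$ with stabilizer $G_x$, and assume that $G/G_x$ is endowed with a smooth manifold structure which turns the quotient map $q\colon G\to G/G_x$, $g\mapsto gG_x$ into a smooth submersion. Then the orbit map $G\to M$,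 $g\mapsto gx$ factors to a $C^1$-map $$\widetilde{b}\colon G/G_x\to M,\quad gG_x\mapsto gx,$$ and for each $g\in G$ the tangent map $T_{gG_x}\widetilde{b}\colon T_{gG_x}(G/G_x)\to T_{gx}M$ is injective. -/

import Mathlib

open Filter Topology Set

noncomputable section

namespace LC

/-! Differential calculus in real topological vector spaces (Keller's `C^r_c`, i.e. Michal-Bastiani
calculus). -/

section Calculus

universe u v

/-- `w` is the directional derivative of `f` at `x` in the direction `y`. -/
def HasDirDeriv {E : Type u} {F : Type v} [AddCommGroup E] [Module ℝ E]
    [AddCommGroup F] [Module ℝ F] [TopologicalSpace F]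
    (f : E → F) (w : F) (x y : E) : Prop :=
  Tendsto (fun t : ℝ => t⁻¹ • (f (x + t • y) - f x)) (𝓝[≠] 0) (𝓝 w)

/-- The directional derivative `df(x, y)` (an arbitrary value if it does not exist). -/
def dirDeriv {E : Type u} {F : Type v} [AddCommGroup E] [Module ℝ E]
    [AddCommGroup F] [Module ℝ F] [TopologicalSpace F]
    (f : E → F) (x y : E) : F :=
  limUnder (𝓝[≠] (0 : ℝ)) (fun t : ℝ => t⁻¹ • (f (x + t • y) - f x))

/-- `f` is `C^k` on the open set `U`, for finite `k`: it is continuous there and, if `k = n + 1`,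
the directional derivatives `df(x, y)` exist for all `x ∈ U`, `y ∈ E` and `df : U × E → F` is
`C^n`. -/
def IsCk : (k : ℕ) → {E : Type u} → {F : Type v} →
    [AddCommGroup E] → [Module ℝ E] → [TopologicalSpace E] →
    [AddCommGroup F] → [Module ℝ F] → [TopologicalSpace F] →
    (E → F) → Set E → Prop
  | 0, _, _, _, _, _, _, _, _, f, U => ContinuousOn f U
  | n + 1, E, F, _, _, _, _, _, _, f, U =>
      ContinuousOn f U ∧ ∃ df : E × E → F,
        (∀ x ∈ U, ∀ y : E, HasDirDeriv f (df (x, y)) x y) ∧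
        IsCk n df (U ×ˢ (univ : Set E))

/-- `f` is `C^r` on the open set `U`, where `r ∈ {0, 1, 2, …} ∪ {∞}`. -/
def IsCr {E : Type u} {F : Type v} [AddCommGroup E] [Module ℝ E] [TopologicalSpace E]
    [AddCommGroup F] [Module ℝ F] [TopologicalSpace F]
    (r : ℕ∞) (f : E → F) (U : Set E) : Prop :=
  ∀ k : ℕ, (k : ℕ∞) ≤ r → IsCk k f U

end Calculus

section Manifolds

/-- The Hausdorff space `M` with the given atlas of charts in `E` is a `C^r`-manifold: all changes
of charts are `C^r`. -/
class IsManifold (r : ℕ∞) (E : Type*) [AddCommGroup E] [Module ℝ E] [TopologicalSpace E]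
    (M : Type*) [TopologicalSpace M] [ChartedSpace E M] : Prop extends T2Space M where
  compatible : ∀ φ ∈ atlas E M, ∀ ψ ∈ atlas E M,
    IsCr r (fun u : E => ψ (φ.symm u)) (φ.symm.trans ψ).source

/-- The `C^r`-charts of `M`, i.e. the elements of the maximal `C^r`-atlas containing the given
atlas. -/
def IsChart (r : ℕ∞) {E : Type*} [AddCommGroup E] [Module ℝ E] [TopologicalSpace E]
    {M : Type*} [TopologicalSpace M] [ChartedSpace E M] (φ : OpenPartialHomeomorph M E) : Prop :=
  ∀ ψ ∈ atlas E M,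
    IsCr r (fun u : E => ψ (φ.symm u)) (φ.symm.trans ψ).source ∧
    IsCr r (fun u : E => φ (ψ.symm u)) (ψ.symm.trans φ).source

/-- The product manifold `M × N`, with the charts `φ × ψ` in `E × F`. -/
instance prodChartedSpace (E : Type*) [TopologicalSpace E] (F : Type*) [TopologicalSpace F]
    (M : Type*) [TopologicalSpace M] [ChartedSpace E M]
    (N : Type*) [TopologicalSpace N] [ChartedSpace F N] : ChartedSpace (E × F) (M × N) :=
  _root_.prodChartedSpace E M F N

variable (E : Type*) [AddCommGroup E] [Module ℝ E] [TopologicalSpace E]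
  (F : Type*) [AddCommGroup F] [Module ℝ F] [TopologicalSpace F]
  {M : Type*} [TopologicalSpace M] [ChartedSpace E M]
  {N : Type*} [TopologicalSpace N] [ChartedSpace F N]

/-- `f : M → N` is a `C^r`-map between manifolds modelled on `E` and `F`. -/
def IsCrMap (r : ℕ∞) (f : M → N) : Prop :=
  Continuous f ∧ ∀ φ ∈ atlas E M, ∀ ψ ∈ atlas F N,
    IsCr r (fun u : E => ψ (f (φ.symm u))) (φ.target ∩ φ.symm ⁻¹' (f ⁻¹' ψ.source))

/-- `f : M → N` is a `C^r`-submersion: in suitable `C^r`-charts around each point and its image, it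
is the restriction of a continuous linear map with a continuous linear right inverse. -/
def IsSubmersion (r : ℕ∞) (f : M → N) : Prop :=
  IsCrMap E F r f ∧ ∀ x : M, ∃ (φ : OpenPartialHomeomorph M E) (ψ : OpenPartialHomeomorph N F),
    IsChart r φ ∧ IsChart r ψ ∧ x ∈ φ.source ∧ f x ∈ ψ.source ∧ MapsTo f φ.source ψ.source ∧
    ∃ (π : E →L[ℝ] F) (σ : F →L[ℝ] E), π.comp σ = ContinuousLinearMap.id ℝ F ∧
      ∀ u ∈ φ.target, ψ (f (φ.symm u)) = π u

/-- The tangent space `T_x M`. As Mathlib does for manifolds modelled on normed spaces, it is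
identified with the modelling space `E` by means of the preferred chart `chartAt E x`. -/
@[nolint unusedArguments]
abbrev TangentAt (_x : M) : Type _ := E

/-- The tangent map `T_x f : T_x M → T_{f(x)} N` of a `C^1`-map `f : M → N`; this is the
differential at `x` of `f`, read in the charts at `x` and `f x` which identify the tangent spaces
with `E` and `F`. -/
def tangentMap (f : M → N) (x : M) : TangentAt E x → TangentAt F (f x) :=
  fun y => dirDeriv (fun u : E => chartAt F (f x) (f ((chartAt E x).symm u))) (chartAt E x x) y

end Manifolds

section LieGroups

variable (E : Type*) [AddCommGroup E] [Module ℝ E] [TopologicalSpace E]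
  (G : Type*) [Group G] [TopologicalSpace G] [ChartedSpace E G]

/-- `G` is a smooth Lie group modelled on `E`. -/
class IsLieGroup : Prop extends IsManifold ⊤ E G where
  smooth_mul : IsCrMap (E × E) E ⊤ (fun p : G × G => p.1 * p.2)
  smooth_inv : IsCrMap E E ⊤ (fun g : G => g⁻¹)

/-- `G` has an exponential function: each `v ∈ L(G) = T_1 G` is the velocity `γ'(0)` of a smooth
homomorphism `γ : (ℝ, +) → G`. -/
def HasExponential : Prop :=
  ∀ v : TangentAt E (1 : G), ∃ γ : ℝ → G, (∀ s t : ℝ, γ (s + t) = γ s * γ t) ∧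
    IsCrMap ℝ E ⊤ γ ∧ HasDirDeriv (fun t : ℝ => chartAt E (1 : G) (γ t)) v 0 1

end LieGroups

end LC

end

/-! Write `b` for the factored map and `q` for the quotient map. A submersion has local
`C^1`-sections: in submersion charts, use an affine right inverse of the linear map. If `s` is such
a section of `q`, then `b y = s y • x` locally, so `b` is `C^1`.

Tangent maps respect differences, so injectivity reduces to a trivial kernel. Let `v` be a kernel
vector at `gG_x`. Translating `s` by `g⁻¹` lifts `v` to some `w` in `T_1 G`; let `γ` be the
one-parameter group with velocity `w`. Then `t ↦ gγ(t)G_x` has velocity `v` at `0`, and its image `t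
↦ gγ(t)x` has velocity `0` there. The homomorphism law carries this to every time, so `t ↦ γ(t)x`
has zero velocity throughout and is constant (`IsCrMap.oneParameter_smul_eq`). Hence `γ` stays in
`G_x`, the curve `gγ(t)G_x` is constant, and `v = 0`.

The calculus rests on a mean value theorem for closed convex sets, obtained from Hahn-Banach. It
yields strict differentiability of `C^1`-maps, and from that the chain rule and additivity. -/

noncomputable section

namespace LC

/-! ### Directional derivatives and the mean value theorem -/

section DirectionalDerivatives

variable {E : Type*} [AddCommGroup E] [Module ℝ E]
  {F : Type*} [AddCommGroup F] [Module ℝ F] [TopologicalSpace F]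

theorem HasDirDeriv.unique [T2Space F] {f : E → F} {v w : F} {x y : E}
    (hv : HasDirDeriv f v x y) (hw : HasDirDeriv f w x y) : v = w :=
  tendsto_nhds_unique hv hw

theorem HasDirDeriv.dirDeriv_eq [T2Space F] {f : E → F} {w : F} {x y : E}
    (h : HasDirDeriv f w x y) : dirDeriv f x y = w :=
  h.limUnder_eq

theorem hasDirDeriv_const (c : F) (x y : E) : HasDirDeriv (fun _ => c) 0 x y := by
  simpa [HasDirDeriv] using tendsto_const_nhds

theorem hasDirDeriv_zero (f : E → F) (x : E) : HasDirDeriv f 0 x 0 := by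
  simpa [HasDirDeriv] using tendsto_const_nhds

theorem hasDirDeriv_of_linear (f : E →ₗ[ℝ] F) (x y : E) : HasDirDeriv f (f y) x y := by
  refine tendsto_const_nhds.congr' ?_
  filter_upwards [self_mem_nhdsWithin] with t ht
  have ht : t ≠ 0 := ht
  simp [smul_smul, ht]

theorem HasDirDeriv.congr [TopologicalSpace E] [IsTopologicalAddGroup E] [ContinuousSMul ℝ E]
    {f g : E → F} {w : F} {x y : E} (h : HasDirDeriv f w x y) (hfg : f =ᶠ[𝓝 x] g) :
    HasDirDeriv g w x y := by
  have hx : Tendsto (fun t : ℝ => x + t • y) (𝓝[≠] 0) (𝓝 x) := by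
    have : Continuous (fun t : ℝ => x + t • y) := by fun_prop
    simpa using (this.tendsto 0).mono_left nhdsWithin_le_nhds
  refine Tendsto.congr' ?_ h
  filter_upwards [hx.eventually hfg] with t ht
  rw [ht, hfg.eq_of_nhds]

theorem HasDirDeriv.smul_right [ContinuousSMul ℝ F] {f : E → F} {w : F} {x y : E}
    (h : HasDirDeriv f w x y) (c : ℝ) : HasDirDeriv f (c • w) x (c • y) := by
  by_cases hc : c = 0
  · simpa [hc] using hasDirDeriv_zero f x
  · have h1 : Tendsto (fun t : ℝ => t * c) (𝓝[≠] 0) (𝓝[≠] 0) := by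
      refine tendsto_nhdsWithin_iff.2 ⟨?_, ?_⟩
      · have : Continuous (fun t : ℝ => t * c) := by fun_prop
        simpa using (this.tendsto 0).mono_left nhdsWithin_le_nhds
      · filter_upwards [self_mem_nhdsWithin] with t ht
        exact mul_ne_zero ht hc
    refine ((h.comp h1).const_smul c).congr' ?_
    filter_upwards [self_mem_nhdsWithin] with t ht
    have ht : t ≠ 0 := ht
    simp only [Function.comp, smul_smul]
    congr 1
    field_simp

theorem HasDirDeriv.hasDerivAt_comp_line {f : E → F} {p v : E} {s : ℝ} {w : F}
    (h : HasDirDeriv f w (p + s • v) v) (l : F →L[ℝ] ℝ) :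
    HasDerivAt (fun s : ℝ => l (f (p + s • v))) (l w) s := by
  rw [hasDerivAt_iff_tendsto_slope_zero]
  refine ((l.continuous.tendsto w).comp h).congr fun t => ?_
  simp only [Function.comp, map_smul, map_sub, add_smul, add_assoc]

/-- The mean value theorem: a difference quotient lies in every closed convex set that contains
all directional derivatives along the segment. -/
theorem smul_sub_mem_of_hasDirDeriv [IsTopologicalAddGroup F] [ContinuousSMul ℝ F]
    [LocallyConvexSpace ℝ F] {f : E → F} {p w : E} {t : ℝ} (ht : t ≠ 0) {K : Set F}
    (hKc : Convex ℝ K) (hKcl : IsClosed K) (d : ℝ → F)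
    (hd : ∀ s ∈ Icc (0 : ℝ) 1, HasDirDeriv f (d s) (p + (s * t) • w) w ∧ d s ∈ K) :
    t⁻¹ • (f (p + t • w) - f p) ∈ K := by
  by_contra hn
  -- A functional strictly separating the quotient from `K` reduces the claim to the mean value
  -- theorem on `[0, 1]`, which finds `s` where `l` takes the same value on `d s` and on the
  -- quotient.
  obtain ⟨l, u, hl, hu⟩ := geometric_hahn_banach_closed_point hKc hKcl hn
  have hder : ∀ s ∈ Icc (0 : ℝ) 1,
      HasDerivAt (fun s : ℝ => l (f (p + s • (t • w)))) (t * l (d s)) s := by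
    intro s hs
    have h1 := ((hd s hs).1.smul_right t)
    rw [← smul_smul] at h1
    simpa using h1.hasDerivAt_comp_line l
  obtain ⟨s, hs, hs'⟩ := exists_hasDerivAt_eq_slope _ (fun s => t * l (d s)) zero_lt_one
    (fun s hs => (hder s hs).continuousAt.continuousWithinAt)
    (fun s hs => hder s (Ioo_subset_Icc_self hs))
  have h2 := hl _ (hd s (Ioo_subset_Icc_self hs)).2
  have h3 : l (t⁻¹ • (f (p + t • w) - f p)) = l (d s) := by
    simp only [one_smul, zero_smul, add_zero, sub_zero, div_one] at hs'
    rw [map_smul, map_sub, ← hs', smul_eq_mul]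
    field_simp
  linarith

end DirectionalDerivatives

theorem exists_isClosed_convex_mem_nhds {F : Type*} [AddCommGroup F] [Module ℝ F]
    [TopologicalSpace F] [IsTopologicalAddGroup F] [ContinuousSMul ℝ F] [LocallyConvexSpace ℝ F]
    {y : F} {N : Set F} (hN : N ∈ 𝓝 y) : ∃ K ∈ 𝓝 y, IsClosed K ∧ Convex ℝ K ∧ K ⊆ N := by
  obtain ⟨C, ⟨hC, hCcl⟩, hCN⟩ := (closed_nhds_basis y).mem_iff.1 hN
  obtain ⟨S, ⟨hS, hSc⟩, hSC⟩ := (LocallyConvexSpace.convex_basis (𝕜 := ℝ) y).mem_iff.1 hC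
  exact ⟨closure S, mem_of_superset hS subset_closure, isClosed_closure, hSc.closure,
    (closure_minimal hSC hCcl).trans hCN⟩

/-! ### `C^1`-maps between locally convex spaces -/

section ContinuouslyDifferentiable

variable {E : Type*} [AddCommGroup E] [Module ℝ E] [TopologicalSpace E]
  {F : Type*} [AddCommGroup F] [Module ℝ F] [TopologicalSpace F]
  {H : Type*} [AddCommGroup H] [Module ℝ H] [TopologicalSpace H]

/-- `f` is `C^1` on a neighbourhood of `x`. -/
def C1At (f : E → F) (x : E) : Prop :=
  ∃ U, IsOpen U ∧ x ∈ U ∧ IsCk 1 f U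

theorem isCk_one_iff {f : E → F} {U : Set E} : IsCk 1 f U ↔ ContinuousOn f U ∧
    ∃ df : E × E → F, (∀ x ∈ U, ∀ y : E, HasDirDeriv f (df (x, y)) x y) ∧
      ContinuousOn df (U ×ˢ (univ : Set E)) :=
  Iff.rfl

theorem IsCk.c1At {f : E → F} {U : Set E} (h : IsCk 1 f U) (hU : IsOpen U) {x : E} (hx : x ∈ U) :
    C1At f x :=
  ⟨U, hU, hx, h⟩

theorem C1At.eventually {f : E → F} {x : E} (h : C1At f x) : ∀ᶠ y in 𝓝 x, C1At f y := by
  obtain ⟨U, hU, hx, hf⟩ := h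
  filter_upwards [hU.mem_nhds hx] with y hy
  exact ⟨U, hU, hy, hf⟩

theorem C1At.continuousAt {f : E → F} {x : E} (h : C1At f x) : ContinuousAt f x := by
  obtain ⟨U, hU, hx, hf⟩ := h
  exact hf.1.continuousAt (hU.mem_nhds hx)

theorem C1At.hasDirDeriv [T2Space F] {f : E → F} {x : E} (h : C1At f x) (y : E) :
    HasDirDeriv f (dirDeriv f x y) x y := by
  obtain ⟨U, hU, hx, hf⟩ := h
  obtain ⟨df, hdf, -⟩ := (isCk_one_iff.1 hf).2
  rw [(hdf x hx y).dirDeriv_eq]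
  exact hdf x hx y

/-- Limits in `F` are unique, so any witness `df` agrees with `dirDeriv` over `U`. This canonical
choice lets local data be glued in `isCk_one_of_forall_c1At`. -/
theorem C1At.continuousAt_dirDeriv [T2Space F] {f : E → F} {x : E} (h : C1At f x) (y : E) :
    ContinuousAt (fun p : E × E => dirDeriv f p.1 p.2) (x, y) := by
  obtain ⟨U, hU, hx, hf⟩ := h
  obtain ⟨df, hdf, hc⟩ := (isCk_one_iff.1 hf).2
  have hm : U ×ˢ (univ : Set E) ∈ 𝓝 (x, y) := (hU.prod isOpen_univ).mem_nhds ⟨hx, mem_univ _⟩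
  refine (hc.continuousAt hm).congr ?_
  filter_upwards [hm] with p hp
  exact (hdf p.1 hp.1 p.2).dirDeriv_eq.symm

theorem isCk_one_of_forall_c1At [T2Space F] {f : E → F} {U : Set E} (h : ∀ x ∈ U, C1At f x) :
    IsCk 1 f U :=
  isCk_one_iff.2 ⟨fun x hx => (h x hx).continuousAt.continuousWithinAt,
    fun p => dirDeriv f p.1 p.2, fun x hx y => (h x hx).hasDirDeriv y,
    fun p hp => ((h p.1 hp.1).continuousAt_dirDeriv p.2).continuousWithinAt⟩

theorem C1At.congr [IsTopologicalAddGroup E] [ContinuousSMul ℝ E] {f g : E → F} {x : E}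
    (h : C1At f x) (hfg : f =ᶠ[𝓝 x] g) : C1At g x := by
  obtain ⟨U, hU, hx, hf⟩ := h
  obtain ⟨df, hdf, hc⟩ := (isCk_one_iff.1 hf).2
  obtain ⟨V, hVs, hV, hxV⟩ := mem_nhds_iff.1 hfg
  refine ⟨U ∩ V, hU.inter hV, ⟨hx, hxV⟩, isCk_one_iff.2 ⟨?_, df, fun y hy z => ?_, ?_⟩⟩
  · exact (hf.1.mono inter_subset_left).congr fun y hy => (hVs hy.2).symm
  · refine (hdf y hy.1 z).congr ?_
    filter_upwards [hV.mem_nhds hy.2] with u hu using hVs hu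
  · exact hc.mono (prod_mono inter_subset_left Subset.rfl)

/-- A `C^1`-map is strictly differentiable: the base points and the directions of the difference
quotients may vary. -/
theorem C1At.tendsto_smul_sub [IsTopologicalAddGroup E] [ContinuousSMul ℝ E]
    [IsTopologicalAddGroup F] [ContinuousSMul ℝ F] [LocallyConvexSpace ℝ F] [T2Space F]
    {f : E → F} {x w : E} (h : C1At f x) {p v : ℝ → E}
    (hp : Tendsto p (𝓝[≠] 0) (𝓝 x)) (hv : Tendsto v (𝓝[≠] 0) (𝓝 w)) :
    Tendsto (fun t : ℝ => t⁻¹ • (f (p t + t • v t) - f (p t))) (𝓝[≠] 0)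
      (𝓝 (dirDeriv f x w)) := by
  rw [tendsto_def]
  intro N hN
  obtain ⟨K, hK, hKcl, hKc, hKN⟩ := exists_isClosed_convex_mem_nhds hN
  have h1 : ∀ᶠ a : E × E in 𝓝 (x, w), C1At f a.1 ∧ dirDeriv f a.1 a.2 ∈ K :=
    (continuousAt_fst.eventually h.eventually).and ((h.continuousAt_dirDeriv w).eventually hK)
  have h2 : Tendsto (fun a : ℝ × (E × E) => (a.2.1 + a.1 • a.2.2, a.2.2))
      (𝓝 0 ×ˢ 𝓝 (x, w)) (𝓝 (x, w)) := by
    have : Continuous (fun a : ℝ × (E × E) => (a.2.1 + a.1 • a.2.2, a.2.2)) := by fun_prop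
    have := this.tendsto (0, (x, w))
    rwa [nhds_prod_eq, zero_smul, add_zero] at this
  -- The product filter separates the condition on the scalar from that on `(p t, v t)`, so one `δ`
  -- serves all scalars `s * t` with `s ∈ [0, 1]`, that is, the whole segment.
  obtain ⟨A, hA, B, hB, hAB⟩ := eventually_prod_iff.1 (h2.eventually h1)
  obtain ⟨δ, hδ, hδA⟩ := Metric.eventually_nhds_iff.1 hA
  have h3 : ∀ᶠ t in 𝓝[≠] (0 : ℝ), dist t 0 < δ :=
    nhdsWithin_le_nhds (Metric.ball_mem_nhds _ hδ)
  filter_upwards [h3, (hp.prodMk_nhds hv).eventually hB, self_mem_nhdsWithin] with t ht hBt ht0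
  refine hKN (smul_sub_mem_of_hasDirDeriv ht0 hKc hKcl
    (fun s => dirDeriv f (p t + (s * t) • v t) (v t)) fun s hs => ?_)
  have hst : dist (s * t) 0 < δ := by
    rw [Real.dist_0_eq_abs] at ht ⊢
    rw [abs_mul, abs_of_nonneg hs.1]
    exact (mul_le_of_le_one_left (abs_nonneg t) hs.2).trans_lt ht
  exact ⟨(hAB (hδA hst) hBt).1.hasDirDeriv _, (hAB (hδA hst) hBt).2⟩

/-- The quotient in direction `y - z` at the moving base point `x + t • z` is the difference of the
quotients for `y` and `z` at `x`; strict differentiability permits the moving base point. -/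
theorem C1At.dirDeriv_sub [IsTopologicalAddGroup E] [ContinuousSMul ℝ E]
    [IsTopologicalAddGroup F] [ContinuousSMul ℝ F] [LocallyConvexSpace ℝ F] [T2Space F]
    {f : E → F} {x : E} (h : C1At f x) (y z : E) :
    dirDeriv f x (y - z) = dirDeriv f x y - dirDeriv f x z := by
  have hp : Tendsto (fun t : ℝ => x + t • z) (𝓝[≠] 0) (𝓝 x) := by
    have : Continuous (fun t : ℝ => x + t • z) := by fun_prop
    simpa using (this.tendsto 0).mono_left nhdsWithin_le_nhds
  refine tendsto_nhds_unique (h.tendsto_smul_sub hp (tendsto_const_nhds (x := y - z)))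
    (((h.hasDirDeriv y).sub (h.hasDirDeriv z)).congr fun t => ?_)
  rw [← smul_sub, sub_sub_sub_cancel_right, add_assoc, ← smul_add, add_sub_cancel]

/-- The chain rule. -/
theorem C1At.hasDirDeriv_comp {D : Type*} [AddCommGroup D] [Module ℝ D]
    [IsTopologicalAddGroup E] [ContinuousSMul ℝ E]
    [IsTopologicalAddGroup F] [ContinuousSMul ℝ F] [LocallyConvexSpace ℝ F] [T2Space F]
    {f : E → F} {h : D → E} {x y : D} {w : E} (hf : C1At f (h x)) (hh : HasDirDeriv h w x y) :
    HasDirDeriv (fun u => f (h u)) (dirDeriv f (h x) w) x y := by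
  -- The difference quotient of `h` serves as the varying direction, with fixed base point `h x`.
  refine (hf.tendsto_smul_sub tendsto_const_nhds hh).congr' ?_
  filter_upwards [self_mem_nhdsWithin] with t ht
  have ht : t ≠ 0 := ht
  simp [smul_smul, ht]

theorem C1At.comp {D : Type*} [AddCommGroup D] [Module ℝ D] [TopologicalSpace D]
    [IsTopologicalAddGroup E] [ContinuousSMul ℝ E] [T2Space E]
    [IsTopologicalAddGroup F] [ContinuousSMul ℝ F] [LocallyConvexSpace ℝ F] [T2Space F]
    {f : E → F} {h : D → E} {x : D} (hf : C1At f (h x)) (hh : C1At h x) :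
    C1At (fun u => f (h u)) x := by
  have key : ∀ᶠ u in 𝓝 x, C1At f (h u) ∧ C1At h u :=
    (hh.continuousAt.eventually hf.eventually).and hh.eventually
  obtain ⟨U, hUs, hU, hxU⟩ := mem_nhds_iff.1 key
  refine ⟨U, hU, hxU, isCk_one_iff.2 ⟨fun u hu => ?_,
    fun p => dirDeriv f (h p.1) (dirDeriv h p.1 p.2), fun u hu y => ?_, fun p hp => ?_⟩⟩
  · exact ((hUs hu).1.continuousAt.comp (hUs hu).2.continuousAt).continuousWithinAt
  · exact (hUs hu).1.hasDirDeriv_comp ((hUs hu).2.hasDirDeriv y)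
  · obtain ⟨h1, h2⟩ := hUs hp.1
    have h3 : ContinuousAt (fun p : D × D => (h p.1, dirDeriv h p.1 p.2)) p :=
      (ContinuousAt.comp (f := Prod.fst) h2.continuousAt continuousAt_fst).prodMk
        (h2.continuousAt_dirDeriv p.2)
    exact (ContinuousAt.comp (f := fun p : D × D => (h p.1, dirDeriv h p.1 p.2))
      (h1.continuousAt_dirDeriv _) h3).continuousWithinAt

theorem c1At_const (c : F) (x : E) : C1At (fun _ : E => c) x :=
  ⟨univ, isOpen_univ, mem_univ _, isCk_one_iff.2 ⟨continuousOn_const, fun _ => 0,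
    fun x _ y => hasDirDeriv_const c x y, continuousOn_const⟩⟩

theorem c1At_continuousLinearMap (f : E →L[ℝ] F) (x : E) : C1At f x :=
  ⟨univ, isOpen_univ, mem_univ _, isCk_one_iff.2 ⟨f.continuous.continuousOn, fun p => f p.2,
    fun x _ y => hasDirDeriv_of_linear (f : E →ₗ[ℝ] F) x y, by fun_prop⟩⟩

theorem c1At_add_const [IsTopologicalAddGroup E] (c x : E) : C1At (fun u : E => u + c) x := by
  refine ⟨univ, isOpen_univ, mem_univ _, isCk_one_iff.2 ⟨by fun_prop, fun p => p.2,
    fun x _ y => ?_, by fun_prop⟩⟩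
  refine tendsto_const_nhds.congr' ?_
  filter_upwards [self_mem_nhdsWithin] with t ht
  have ht : t ≠ 0 := ht
  rw [add_sub_add_right_eq_sub, add_sub_cancel_left, smul_smul, inv_mul_cancel₀ ht, one_smul]

theorem C1At.prodMk {f : E → F} {g : E → H} {x : E} (hf : C1At f x) (hg : C1At g x) :
    C1At (fun u => (f u, g u)) x := by
  obtain ⟨U, hU, hxU, hf⟩ := hf
  obtain ⟨V, hV, hxV, hg⟩ := hg
  obtain ⟨df, hdf, hdfc⟩ := (isCk_one_iff.1 hf).2
  obtain ⟨dg, hdg, hdgc⟩ := (isCk_one_iff.1 hg).2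
  refine ⟨U ∩ V, hU.inter hV, ⟨hxU, hxV⟩, isCk_one_iff.2
    ⟨(hf.1.mono inter_subset_left).prodMk (hg.1.mono inter_subset_right),
    fun p => (df p, dg p), fun u hu y => ?_, ?_⟩⟩
  · exact (hdf u hu.1 y).prodMk_nhds (hdg u hu.2 y)
  · exact (hdfc.mono (prod_mono inter_subset_left Subset.rfl)).prodMk
      (hdgc.mono (prod_mono inter_subset_right Subset.rfl))

/-- A curve whose derivative vanishes near a point is constant near this point. -/
theorem eventually_eq_of_hasDirDeriv_zero [IsTopologicalAddGroup F] [ContinuousSMul ℝ F]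
    [LocallyConvexSpace ℝ F] [T2Space F] {c : ℝ → F} {a : ℝ}
    (h : ∀ᶠ t in 𝓝 a, HasDirDeriv c 0 t 1) : ∀ᶠ t in 𝓝 a, c t = c a := by
  obtain ⟨δ, hδ, hδA⟩ := Metric.eventually_nhds_iff.1 h
  filter_upwards [Metric.ball_mem_nhds a hδ] with t ht
  by_cases hta : t = a
  · rw [hta]
  have hta' : t - a ≠ 0 := sub_ne_zero.2 hta
  have := smul_sub_mem_of_hasDirDeriv (f := c) (p := a) (w := (1 : ℝ)) hta'
    (convex_singleton (0 : F)) isClosed_singleton (fun _ => 0) fun s hs => ⟨hδA ?_, rfl⟩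
  · rw [mem_singleton_iff, smul_eq_zero_iff_right (inv_ne_zero hta'), sub_eq_zero] at this
    simpa using this
  · rw [Metric.mem_ball, Real.dist_eq] at ht
    rw [Real.dist_eq, smul_eq_mul, mul_one, add_sub_cancel_left, abs_mul, abs_of_nonneg hs.1]
    exact (mul_le_of_le_one_left (abs_nonneg _) hs.2).trans_lt ht

end ContinuouslyDifferentiable

/-! ### Domains of chart representations -/

section ChartDomains

variable {E F M N : Type*} [TopologicalSpace E] [TopologicalSpace F] [TopologicalSpace M]
  [TopologicalSpace N]

theorem isOpen_target_inter_preimage {f : M → N} (hf : Continuous f)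
    (φ : OpenPartialHomeomorph M E) (ψ : OpenPartialHomeomorph N F) :
    IsOpen (φ.target ∩ φ.symm ⁻¹' (f ⁻¹' ψ.source)) :=
  φ.isOpen_inter_preimage_symm (ψ.open_source.preimage hf)

theorem mem_target_inter_preimage {f : M → N} {φ : OpenPartialHomeomorph M E}
    {ψ : OpenPartialHomeomorph N F} {x : M} (hx : x ∈ φ.source) (hfx : f x ∈ ψ.source) :
    φ x ∈ φ.target ∩ φ.symm ⁻¹' (f ⁻¹' ψ.source) :=
  ⟨φ.map_source hx, by simpa [φ.left_inv hx] using hfx⟩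

end ChartDomains

/-! ### `C^1`-maps between manifolds, local sections and curves -/

section MapsBetweenManifolds

theorem IsCr.isCk_one {E : Type*} {F : Type*} [AddCommGroup E] [Module ℝ E] [TopologicalSpace E]
    [AddCommGroup F] [Module ℝ F] [TopologicalSpace F] {r : ℕ∞} (hr : 1 ≤ r) {f : E → F}
    {U : Set E} (h : IsCr r f U) : IsCk 1 f U :=
  h 1 (by exact_mod_cast hr)

theorem isCr_one_of_isCk_one {E : Type*} {F : Type*} [AddCommGroup E] [Module ℝ E]
    [TopologicalSpace E] [AddCommGroup F] [Module ℝ F] [TopologicalSpace F] {f : E → F}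
    {U : Set E} (h : IsCk 1 f U) : IsCr 1 f U := by
  intro k hk
  have hk : k ≤ 1 := by exact_mod_cast hk
  interval_cases k
  · exact (isCk_one_iff.1 h).1
  · exact h

variable (D : Type*) [AddCommGroup D] [Module ℝ D] [TopologicalSpace D]
  (E : Type*) [AddCommGroup E] [Module ℝ E] [TopologicalSpace E]
  (F : Type*) [AddCommGroup F] [Module ℝ F] [TopologicalSpace F]
  {L : Type*} [TopologicalSpace L] [ChartedSpace D L]
  {M : Type*} [TopologicalSpace M] [ChartedSpace E M]
  {N : Type*} [TopologicalSpace N] [ChartedSpace F N]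

/-- `f` is continuous at `x`, and `C^1` near `x` in all charts of the given atlases. -/
def C1MapAt (f : M → N) (x : M) : Prop :=
  ContinuousAt f x ∧ ∀ φ ∈ atlas E M, ∀ ψ ∈ atlas F N, x ∈ φ.source → f x ∈ ψ.source →
    C1At (fun u : E => ψ (f (φ.symm u))) (φ x)

variable {E F}

theorem IsCrMap.c1MapAt {r : ℕ∞} (hr : 1 ≤ r) {f : M → N} (hf : IsCrMap E F r f) (x : M) :
    C1MapAt E F f x :=
  ⟨hf.1.continuousAt, fun φ hφ ψ hψ hx hfx => ((hf.2 φ hφ ψ hψ).isCk_one hr).c1At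
    (isOpen_target_inter_preimage hf.1 φ ψ) (mem_target_inter_preimage hx hfx)⟩

theorem isCrMap_one_of_forall_c1MapAt [T2Space F] {f : M → N} (hf : ∀ x, C1MapAt E F f x) :
    IsCrMap E F 1 f := by
  refine ⟨continuous_iff_continuousAt.2 fun x => (hf x).1, fun φ hφ ψ hψ =>
    isCr_one_of_isCk_one (isCk_one_of_forall_c1At fun u hu => ?_)⟩
  have := (hf (φ.symm u)).2 φ hφ ψ hψ (φ.map_target hu.1) hu.2
  rwa [φ.right_inv hu.1] at this

theorem C1MapAt.congr [IsTopologicalAddGroup E] [ContinuousSMul ℝ E] {f g : M → N} {x : M}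
    (hf : C1MapAt E F f x) (hfg : f =ᶠ[𝓝 x] g) : C1MapAt E F g x := by
  refine ⟨hf.1.congr hfg, fun φ hφ ψ hψ hx hgx => ?_⟩
  refine (hf.2 φ hφ ψ hψ hx (by rwa [hfg.eq_of_nhds])).congr ?_
  have hs : Tendsto φ.symm (𝓝 (φ x)) (𝓝 x) := by
    simpa [φ.left_inv hx] using (φ.continuousAt_symm (φ.map_source hx)).tendsto
  filter_upwards [hs.eventually hfg] with u hu
  rw [hu]

theorem C1MapAt.comp [IsTopologicalAddGroup D] [ContinuousSMul ℝ D]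
    [IsTopologicalAddGroup E] [ContinuousSMul ℝ E] [T2Space E]
    [IsTopologicalAddGroup F] [ContinuousSMul ℝ F] [LocallyConvexSpace ℝ F] [T2Space F]
    {f : M → N} {h : L → M} {x : L} (hf : C1MapAt E F f (h x)) (hh : C1MapAt D E h x) :
    C1MapAt D F (fun y => f (h y)) x := by
  refine ⟨hf.1.comp hh.1, fun φ hφ ψ hψ hx hfx => ?_⟩
  set χ := chartAt E (h x)
  have hχ : h x ∈ χ.source := mem_chart_source E (h x)
  have h1 := hh.2 φ hφ χ (chart_mem_atlas _ _) hx hχ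
  have h2 := hf.2 χ (chart_mem_atlas _ _) ψ hψ hχ hfx
  have h3 := C1At.comp (f := fun u : E => ψ (f (χ.symm u)))
    (h := fun u : D => χ (h (φ.symm u))) (x := φ x) (by simpa [φ.left_inv hx] using h2) h1
  refine h3.congr ?_
  have hs : Tendsto φ.symm (𝓝 (φ x)) (𝓝 x) := by
    simpa [φ.left_inv hx] using (φ.continuousAt_symm (φ.map_source hx)).tendsto
  filter_upwards [(hh.1.tendsto.comp hs).eventually (χ.open_source.mem_nhds hχ)] with u hu
  exact congrArg (fun y => ψ (f y)) (χ.left_inv hu)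

theorem c1MapAt_const (c : N) (x : M) : C1MapAt E F (fun _ : M => c) x :=
  ⟨continuousAt_const, fun _ _ _ _ _ _ => c1At_const _ _⟩

theorem c1MapAt_id {r : ℕ∞} (hr : 1 ≤ r) [hM : IsManifold r E M] (x : M) :
    C1MapAt E E (fun y : M => y) x :=
  ⟨continuousAt_id, fun φ hφ ψ hψ hx hfx => ((hM.compatible φ hφ ψ hψ).isCk_one hr).c1At
    (φ.symm.trans ψ).open_source (by
      simpa using mem_target_inter_preimage (f := fun y : M => y) hx hfx)⟩

theorem C1MapAt.prodMk {f : L → M} {g : L → N} {x : L} (hf : C1MapAt D E f x)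
    (hg : C1MapAt D F g x) : C1MapAt D (E × F) (fun y => (f y, g y)) x := by
  refine ⟨hf.1.prodMk hg.1, fun φ hφ ψ hψ hx hfx => ?_⟩
  obtain ⟨α, hα, β, hβ, rfl⟩ := hψ
  exact (hf.2 φ hφ α hα hx hfx.1).prodMk (hg.2 φ hφ β hβ hx hfx.2)

theorem C1At.c1MapAt {f : E → F} {x : E} (hf : C1At f x) : C1MapAt E F f x := by
  refine ⟨hf.continuousAt, fun φ hφ ψ hψ _ _ => ?_⟩
  rw [chartedSpaceSelf_atlas] at hφ hψ
  subst hφ hψ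
  exact hf

/-- Submersions are described in charts of the maximal atlas, while `C1MapAt` tests only the given
one. Viewing such charts as `C^1`-maps to the modelling space lets `C1MapAt.comp` bridge the two. -/
theorem IsChart.c1MapAt {r : ℕ∞} (hr : 1 ≤ r) {φ : OpenPartialHomeomorph M E} (hφ : IsChart r φ)
    {x : M} (hx : x ∈ φ.source) : C1MapAt E E φ x := by
  refine ⟨φ.continuousAt hx, fun χ hχ ψ hψ hxχ _ => ?_⟩
  rw [chartedSpaceSelf_atlas] at hψ
  subst hψ
  exact ((hφ χ hχ).2.isCk_one hr).c1At (χ.symm.trans φ).open_source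
    (by simpa using mem_target_inter_preimage (f := fun y : M => y) hxχ hx)

theorem IsChart.c1MapAt_symm {r : ℕ∞} (hr : 1 ≤ r) {φ : OpenPartialHomeomorph M E}
    (hφ : IsChart r φ) {u : E} (hu : u ∈ φ.target) : C1MapAt E E φ.symm u := by
  refine ⟨φ.continuousAt_symm hu, fun ψ hψ χ hχ _ hxχ => ?_⟩
  rw [chartedSpaceSelf_atlas] at hψ
  subst hψ
  exact ((hφ χ hχ).1.isCk_one hr).c1At (φ.symm.trans χ).open_source (by simpa using ⟨hu, hxχ⟩)

/-- Submersions have local `C^1`-sections. -/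
theorem IsSubmersion.exists_c1_section {r : ℕ∞} (hr : 1 ≤ r) [IsTopologicalAddGroup E]
    [ContinuousSMul ℝ E] [LocallyConvexSpace ℝ E] [T2Space E] [IsTopologicalAddGroup F]
    [ContinuousSMul ℝ F] [T2Space F] {f : M → N} (hf : IsSubmersion E F r f) (x : M) :
    ∃ s : N → M, s (f x) = x ∧ C1MapAt F E s (f x) ∧ ∀ᶠ y in 𝓝 (f x), f (s y) = y := by
  obtain ⟨φ, ψ, hφ, hψ, hx, hfx, hmaps, π, σ, hπσ, hπ⟩ := hf.2 x
  -- The translation makes `k` send `ψ (f x)` to `φ x`; as `π (φ x) = ψ (f x)`, `k` is still a right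
  -- inverse of `π`.
  set k : F → E := fun v => σ v + (φ x - σ (ψ (f x)))
  have hkx : k (ψ (f x)) = φ x := add_sub_cancel _ _
  have hk : ∀ v, C1At k v := fun v =>
    (c1At_add_const (φ x - σ (ψ (f x))) (σ v)).comp (c1At_continuousLinearMap σ v)
  have hψx : C1MapAt F F ψ (f x) := hψ.c1MapAt hr hfx
  have hkψ : C1MapAt F E (fun y => k (ψ y)) (f x) :=
    ((hk _).c1MapAt).comp F hψx
  have hs : C1MapAt F E (fun y => φ.symm (k (ψ y))) (f x) :=
    C1MapAt.comp (f := φ.symm) (h := fun y => k (ψ y)) F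
      (hφ.c1MapAt_symm hr (by simpa [hkx] using φ.map_source hx)) hkψ
  refine ⟨fun y => φ.symm (k (ψ y)), by simp [hkx, φ.left_inv hx], hs, ?_⟩
  have hkt : ∀ᶠ y in 𝓝 (f x), k (ψ y) ∈ φ.target :=
    hkψ.1.eventually (φ.open_target.mem_nhds (by simpa [hkx] using φ.map_source hx))
  filter_upwards [hkt, ψ.open_source.mem_nhds hfx] with y hy hyψ
  refine ψ.injOn (hmaps (φ.map_target hy)) hyψ ?_
  have hπσ' : ∀ v, π (σ v) = v := fun v => DFunLike.congr_fun hπσ v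
  have hπx : π (φ x) = ψ (f x) := by
    rw [← hπ _ (φ.map_source hx), φ.left_inv hx]
  rw [hπ _ hy]
  simp [k, hπσ', hπx]

variable {D}

/-- The chain rule for a `C^1`-map `f` and a map `c` into its domain. -/
theorem C1MapAt.hasDirDeriv_comp {V : Type*} [AddCommGroup V] [Module ℝ V] [TopologicalSpace V]
    [IsTopologicalAddGroup V] [ContinuousSMul ℝ V] [IsTopologicalAddGroup E] [ContinuousSMul ℝ E]
    [IsTopologicalAddGroup F] [ContinuousSMul ℝ F] [LocallyConvexSpace ℝ F] [T2Space F]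
    {f : M → N} {c : V → M} {a y : V} {w : E} (hf : C1MapAt E F f (c a)) (hca : ContinuousAt c a)
    {φ : OpenPartialHomeomorph M E} (hφ : φ ∈ atlas E M) (ha : c a ∈ φ.source)
    {ψ : OpenPartialHomeomorph N F} (hψ : ψ ∈ atlas F N) (hfa : f (c a) ∈ ψ.source)
    (hc : HasDirDeriv (fun t => φ (c t)) w a y) :
    HasDirDeriv (fun t => ψ (f (c t)))
      (dirDeriv (fun u : E => ψ (f (φ.symm u))) (φ (c a)) w) a y := by
  have h1 := C1At.hasDirDeriv_comp (f := fun u : E => ψ (f (φ.symm u)))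
    (h := fun t => φ (c t)) (x := a) (hf.2 φ hφ ψ hψ ha hfa) hc
  refine h1.congr ?_
  filter_upwards [hca.eventually (φ.open_source.mem_nhds ha)] with t ht
  rw [φ.left_inv ht]

/-- A curve with vanishing velocity is constant. -/
theorem eq_of_forall_hasDirDeriv_zero [IsTopologicalAddGroup E] [ContinuousSMul ℝ E]
    [LocallyConvexSpace ℝ E] [T2Space E] {c : ℝ → M} (hc : Continuous c)
    (h : ∀ t, ∀ φ ∈ atlas E M, c t ∈ φ.source → HasDirDeriv (fun s => φ (c s)) 0 t 1) (s t : ℝ) :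
    c s = c t := by
  refine IsLocallyConstant.apply_eq_of_preconnectedSpace
    ((IsLocallyConstant.iff_eventually_eq c).2 fun a => ?_) s t
  have hs : ∀ᶠ t in 𝓝 a, c t ∈ (chartAt E (c a)).source :=
    hc.continuousAt.eventually
      ((chartAt E (c a)).open_source.mem_nhds (mem_chart_source E (c a)))
  have h0 : ∀ᶠ t in 𝓝 a, HasDirDeriv (fun s => chartAt E (c a) (c s)) 0 t 1 := by
    filter_upwards [hs] with t ht using h t _ (chart_mem_atlas E (c a)) ht
  have h1 := eventually_eq_of_hasDirDeriv_zero (c := fun s => chartAt E (c a) (c s)) h0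
  filter_upwards [hs, h1] with t ht hta
  exact (chartAt E (c a)).injOn ht (mem_chart_source E (c a)) hta

end MapsBetweenManifolds

/-! ### Orbit maps, one-parameter groups and the kernel of the tangent map -/

section Orbits

variable {E : Type*} [AddCommGroup E] [Module ℝ E] [TopologicalSpace E] [IsTopologicalAddGroup E]
  [ContinuousSMul ℝ E] [T2Space E]
  {F : Type*} [AddCommGroup F] [Module ℝ F] [TopologicalSpace F] [IsTopologicalAddGroup F]
  [ContinuousSMul ℝ F] [LocallyConvexSpace ℝ F] [T2Space F]
  {G : Type*} [Group G] [TopologicalSpace G] [ChartedSpace E G]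
  {M : Type*} [TopologicalSpace M] [ChartedSpace F M]

theorem IsLieGroup.c1MapAt_mul_left [LocallyConvexSpace ℝ E] [hG : IsLieGroup E G] (g h : G) :
    C1MapAt E E (fun a : G => g * a) h :=
  C1MapAt.comp (f := fun p : G × G => p.1 * p.2) (h := fun a : G => (g, a)) E
    (hG.smooth_mul.c1MapAt le_top _)
    ((c1MapAt_const g h).prodMk E (c1MapAt_id (le_top : (1 : ℕ∞) ≤ ⊤) h))

variable [MulAction G M] (hact : IsCrMap (E × F) F 1 (fun p : G × M => p.1 • p.2))
include hact

theorem IsCrMap.c1MapAt_smul_const [IsLieGroup E G] (x : M) (g : G) :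
    C1MapAt E F (fun a : G => a • x) g :=
  C1MapAt.comp (f := fun p : G × M => p.1 • p.2) (h := fun a : G => (a, x)) E
    (hact.c1MapAt le_rfl _)
    ((c1MapAt_id (le_top : (1 : ℕ∞) ≤ ⊤) g).prodMk E (c1MapAt_const x g))

theorem IsCrMap.c1MapAt_const_smul [IsManifold 1 F M] (g : G) (x : M) :
    C1MapAt F F (fun y : M => g • y) x :=
  C1MapAt.comp (f := fun p : G × M => p.1 • p.2) (h := fun y : M => (g, y)) F
    (hact.c1MapAt le_rfl _)
    ((c1MapAt_const g x).prodMk F (c1MapAt_id le_rfl x))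

/-- If the curve `t ↦ g γ(t) x` given by a one-parameter group `γ` has velocity `0` at `t = 0`,
then `γ` takes its values in the stabilizer of `x`. -/
theorem IsCrMap.oneParameter_smul_eq [IsLieGroup E G] [IsManifold 1 F M] (x : M) (g : G)
    {γ : ℝ → G} (hγ : ∀ s t, γ (s + t) = γ s * γ t) (hγc : Continuous γ)
    {φ : OpenPartialHomeomorph M F} (hφ : φ ∈ atlas F M) (hgx : g • x ∈ φ.source)
    (h0 : HasDirDeriv (fun t => φ ((g * γ t) • x)) 0 0 1) (t : ℝ) : γ t • x = x := by
  have hγ0 : γ 0 = 1 := by simpa using hγ 0 0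
  have hc : Continuous fun t => γ t • x :=
    (continuous_iff_continuousAt.2 fun a => (hact.c1MapAt_smul_const x a).1).comp hγc
  have hgc : Continuous fun t => (g * γ t) • x := by
    simp only [mul_smul]
    exact (continuous_iff_continuousAt.2 fun y => (hact.c1MapAt_const_smul g y).1).comp hc
  have key := eq_of_forall_hasDirDeriv_zero (E := F) hc (fun t ψ hψ ht => ?_) t 0
  · simpa [hγ0] using key
  -- Acting by `γ t * g⁻¹` moves the curve at time `0` to the orbit curve at time `t`; by the chain
  -- rule the zero velocity moves along.
  · have hmul : ∀ s, (γ t * g⁻¹) • (g * γ s) • x = γ (t + s) • x := fun s => by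
      rw [smul_smul, hγ]
      group
    have h1 := C1MapAt.hasDirDeriv_comp (f := fun y : M => (γ t * g⁻¹) • y)
      (c := fun s => (g * γ s) • x) (a := (0 : ℝ)) (y := 1) (w := (0 : F)) (φ := φ) (ψ := ψ)
      (hact.c1MapAt_const_smul _ _) hgc.continuousAt hφ (by simpa [hγ0] using hgx) hψ
      (by simpa only [hmul, add_zero] using ht) h0
    rw [(hasDirDeriv_zero _ _).dirDeriv_eq] at h1
    simp only [hmul] at h1
    simpa [HasDirDeriv] using h1

variable {Q : Type*} [AddCommGroup Q] [Module ℝ Q] [TopologicalSpace Q] [IsTopologicalAddGroup Q]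
  [ContinuousSMul ℝ Q] [T2Space Q] [LocallyConvexSpace ℝ E] [IsLieGroup E G] {x : M}
  [TopologicalSpace (G ⧸ MulAction.stabilizer G x)]
  [ChartedSpace Q (G ⧸ MulAction.stabilizer G x)]
  (hq : IsSubmersion E Q ⊤ (fun g : G => (g : G ⧸ MulAction.stabilizer G x)))
include hq

/-- The orbit map factors to a `C^1`-map on `G ⧸ G_x`. -/
theorem IsSubmersion.c1MapAt_ofQuotientStabilizer (z : G ⧸ MulAction.stabilizer G x) :
    C1MapAt Q F (MulAction.ofQuotientStabilizer G x) z := by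
  obtain ⟨g, rfl⟩ := QuotientGroup.mk_surjective z
  obtain ⟨s, -, hs, hqs⟩ := hq.exists_c1_section le_top g
  refine (C1MapAt.comp (f := fun a : G => a • x) Q (hact.c1MapAt_smul_const x _) hs).congr ?_
  filter_upwards [hqs] with y hy
  conv_rhs => rw [← hy]
  rfl

/-- The tangent maps of `G ⧸ G_x → M` have trivial kernel. -/
theorem IsSubmersion.eq_zero_of_tangentMap_eq_zero [LocallyConvexSpace ℝ Q] [IsManifold 1 F M]
    (hexp : HasExponential E G) (g : G) (v : Q)
    (hv : tangentMap Q F (MulAction.ofQuotientStabilizer G x)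
      (g : G ⧸ MulAction.stabilizer G x) v = 0) : v = 0 := by
  obtain ⟨s, hsg, hs, hqs⟩ := hq.exists_c1_section le_top g
  set z : G ⧸ MulAction.stabilizer G x := (g : G ⧸ MulAction.stabilizer G x) with hz
  set χ := chartAt Q z
  set χ₁ := chartAt E (1 : G)
  have hzχ : z ∈ χ.source := mem_chart_source Q z
  have hχa : χ ∈ atlas Q (G ⧸ MulAction.stabilizer G x) := chart_mem_atlas Q z
  have hχ₁a : χ₁ ∈ atlas E G := chart_mem_atlas E 1
  have h1χ : (1 : G) ∈ χ₁.source := mem_chart_source E 1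
  have hχz : χ.symm (χ z) = z := χ.left_inv hzχ
  have hχs : Tendsto χ.symm (𝓝 (χ z)) (𝓝 z) := by
    simpa [hχz] using (χ.continuousAt_symm (χ.map_source hzχ)).tendsto
  -- lift `v` to a tangent vector `w` of `G` at `1`
  have hl : C1MapAt Q E (fun y => g⁻¹ * s y) z :=
    C1MapAt.comp (f := fun a : G => g⁻¹ * a) Q (IsLieGroup.c1MapAt_mul_left g⁻¹ _) hs
  have hlz : g⁻¹ * s z = 1 := by rw [hsg, inv_mul_cancel]
  have hw := (hl.2 χ hχa χ₁ hχ₁a hzχ (by simpa only [hlz] using h1χ)).hasDirDeriv v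
  set w := dirDeriv (fun u : Q => χ₁ (g⁻¹ * s (χ.symm u))) (χ z) v
  have hk : C1MapAt E Q (fun a : G => ((g * a : G) : G ⧸ MulAction.stabilizer G x)) 1 :=
    C1MapAt.comp (f := fun a : G => (a : G ⧸ MulAction.stabilizer G x)) E
      (hq.1.c1MapAt le_top _) (IsLieGroup.c1MapAt_mul_left g 1)
  have hk1 : ((g * 1 : G) : G ⧸ MulAction.stabilizer G x) = z := by rw [mul_one]
  have hkw : dirDeriv (fun u : E => χ ((g * χ₁.symm u : G) : G ⧸ MulAction.stabilizer G x))
      (χ₁ 1) w = v := by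
    have h1 := C1MapAt.hasDirDeriv_comp (E := E) (F := Q)
      (f := fun a : G => ((g * a : G) : G ⧸ MulAction.stabilizer G x))
      (c := fun u : Q => g⁻¹ * s (χ.symm u)) (a := χ z) (y := v) (w := w) (φ := χ₁) (ψ := χ)
      (by simpa only [hχz, hlz] using hk)
      (ContinuousAt.comp (f := χ.symm) (g := fun y => g⁻¹ * s y)
        (by simpa only [hχz] using hl.1) (χ.continuousAt_symm (χ.map_source hzχ)))
      hχ₁a (by simpa only [hχz, hlz] using h1χ) hχa (by simpa only [hχz, hlz, hk1] using hzχ) hw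
    simp only [hχz, hlz] at h1
    -- Since `g * (g⁻¹ * s y)` maps to `y` in the quotient for `y` near `z`, the composite is
    -- locally the identity in the chart `χ`.
    refine h1.unique ((hasDirDeriv_of_linear LinearMap.id (χ z) v).congr ?_)
    filter_upwards [hχs.eventually hqs, χ.open_target.mem_nhds (χ.map_source hzχ)] with u hu hut
    rw [mul_inv_cancel_left, hu, χ.right_inv hut, LinearMap.id_apply]
  -- the curve `t ↦ g γ(t) G_x` has velocity `v`
  obtain ⟨γ, hγ, hγs, hγw⟩ := hexp w
  have hγ0 : γ 0 = 1 := by simpa using hγ 0 0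
  have hqγ : HasDirDeriv (fun t => χ ((g * γ t : G) : G ⧸ MulAction.stabilizer G x)) v 0 1 := by
    have h1 := C1MapAt.hasDirDeriv_comp (E := E) (F := Q)
      (f := fun a : G => ((g * a : G) : G ⧸ MulAction.stabilizer G x))
      (c := γ) (a := (0 : ℝ)) (y := 1) (w := w) (φ := χ₁) (ψ := χ) (by rwa [hγ0])
      hγs.1.continuousAt hχ₁a (by rwa [hγ0]) hχa (by rwa [hγ0, hk1]) hγw
    rwa [hγ0, hkw] at h1
  have hqc : ContinuousAt (fun t => ((g * γ t : G) : G ⧸ MulAction.stabilizer G x)) 0 :=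
    ContinuousAt.comp (f := γ)
      (g := fun a : G => ((g * a : G) : G ⧸ MulAction.stabilizer G x))
      (by simpa only [hγ0] using hk.1) hγs.1.continuousAt
  -- its image in `M` has velocity `0`
  have hbγ : HasDirDeriv (fun t => chartAt F (g • x) ((g * γ t) • x)) 0 0 1 := by
    have h1 := C1MapAt.hasDirDeriv_comp (E := Q) (F := F)
      (f := MulAction.ofQuotientStabilizer G x)
      (c := fun t => ((g * γ t : G) : G ⧸ MulAction.stabilizer G x))
      (a := (0 : ℝ)) (y := 1) (w := v) (φ := χ) (ψ := chartAt F (g • x))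
      (hq.c1MapAt_ofQuotientStabilizer hact _) hqc hχa (by rwa [hγ0, hk1]) (chart_mem_atlas _ _)
      (by rw [hγ0, hk1]; exact mem_chart_source F (g • x)) hqγ
    rw [hγ0, hk1] at h1
    rwa [← hv]
  have hfix := hact.oneParameter_smul_eq x g hγ hγs.1 (chart_mem_atlas _ _)
    (mem_chart_source F (g • x)) hbγ
  have hconst : ∀ t, ((g * γ t : G) : G ⧸ MulAction.stabilizer G x) = z := fun t => by
    rw [hz, eq_comm, QuotientGroup.eq, inv_mul_cancel_left]
    exact hfix t
  -- The constant curve has velocity `0`, but also velocity `v` by `hqγ`.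
  simp only [hconst] at hqγ
  exact hqγ.unique (hasDirDeriv_const _ _ _)

end Orbits

end LC

end

theorem theoremI
    -- the modelling spaces of `G`, `M` and `G ⧸ G_x`: Hausdorff locally convex spaces
    {E : Type*} [AddCommGroup E] [Module ℝ E] [TopologicalSpace E] [IsTopologicalAddGroup E]
    [ContinuousSMul ℝ E] [LocallyConvexSpace ℝ E] [T2Space E]
    {F : Type*} [AddCommGroup F] [Module ℝ F] [TopologicalSpace F] [IsTopologicalAddGroup F]
    [ContinuousSMul ℝ F] [LocallyConvexSpace ℝ F] [T2Space F]
    {Q : Type*} [AddCommGroup Q] [Module ℝ Q] [TopologicalSpace Q] [IsTopologicalAddGroup Q]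
    [ContinuousSMul ℝ Q] [LocallyConvexSpace ℝ Q] [T2Space Q]
    -- the Lie group `G` with an exponential function
    {G : Type*} [Group G] [TopologicalSpace G] [ChartedSpace E G] [LC.IsLieGroup E G]
    (hexp : LC.HasExponential E G)
    -- the `C^1`-manifold `M` with a `C^1`-action of `G`
    {M : Type*} [TopologicalSpace M] [ChartedSpace F M] [LC.IsManifold 1 F M]
    [MulAction G M] (hact : LC.IsCrMap (E × F) F 1 (fun p : G × M => p.1 • p.2))
    (x : M)
    -- a smooth manifold structure on `G ⧸ G_x` (including its topology; the local instance
    -- takes precedence over the quotient topology) making the quotient map a submersion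
    [TopologicalSpace (G ⧸ MulAction.stabilizer G x)]
    [ChartedSpace Q (G ⧸ MulAction.stabilizer G x)]
    [LC.IsManifold ⊤ Q (G ⧸ MulAction.stabilizer G x)]
    (hq : LC.IsSubmersion E Q ⊤ (fun g : G => (g : G ⧸ MulAction.stabilizer G x))) :
    LC.IsCrMap Q F 1 (MulAction.ofQuotientStabilizer G x) ∧
      ∀ g : G, Function.Injective
        (LC.tangentMap Q F (MulAction.ofQuotientStabilizer G x)
          (g : G ⧸ MulAction.stabilizer G x)) := by
  have hb := hq.c1MapAt_ofQuotientStabilizer hact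
  refine ⟨LC.isCrMap_one_of_forall_c1MapAt hb, fun g v₁ v₂ h => sub_eq_zero.1 ?_⟩
  refine hq.eq_zero_of_tangentMap_eq_zero hact hexp g _ ?_
  exact (((hb g).2 _ (chart_mem_atlas _ _) _ (chart_mem_atlas _ _) (mem_chart_source _ _)
    (mem_chart_source _ _)).dirDeriv_sub v₁ v₂).trans (sub_eq_zero.2 h)
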